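/- Let $G$ be a simplicial group with faces $d_i$ and degeneracies $s_i$. Put $NG_0=G_0$ and $NG_n=\bigcap_{i=0}^{n-1}\ker d_i\subseteq G_n$ for $n\ge 1$, and let $\partial_n:NG_n\to NG_{n-1}$ be the restriction of $d_n$. Let $D_n\subseteq G_n$ be the subgroup generated by the degenerate elements $s_iy$, $y\in G_{n-1}$. Let $S(n)$ be the set of monotone surjections $\alpha:[n]\to[m]$, $0\le m\le n$, each identified with its set of indices $\{i:\alpha(i)=\alpha(i+1)\}=\{i_1<\dots<i_l\}\subseteq\{0,\dots,n-1\}$; write $\#\alpha=l=n-m$ and $s_\alpha=s_{i_l}\cdots s_{i_1}:G_{n-\#\alpha}\to G_n$. Order $S(n)$ by: $\beta<\alpha$, for $\alpha=\{i_1<\dots<i_l\}$ and $\beta=\{j_1<\dots<j_m\}$, if $i_{k+1}<j_{k+1}$ at the first place $k+1$ where the sequences $(i_1,\dots,i_l)$ and $(j_1,\dots,j_m)$ differ, or if the sequence of $\beta$ is a proper initial segment of that of $\alpha$. Let $P(n)$ be the set of pairs $(\alpha,\beta)\in S(n)\times S(n)$ with $\alpha\cap\beta=\emptyset$ and $\beta<\alpha$.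 Let $p=p_{n-1}\cdots p_1p_0:G_n\to NG_n$ (with $p_0$ applied first), where $p_j(z)=z\,s_jd_j(z)^{-1}$, and for $x\in NG_{n-\#\alpha}$, $y\in NG_{n-\#\beta}$ put $F_{\alpha,\beta}(x,y)=p\,[s_\alpha x,s_\beta y]$, where $[a,b]=aba^{-1}b^{-1}$. Let $N_n$ be the normal subgroup of $G_n$ generated by all elements $F_{\alpha,\beta}(x,y)$ with $(\alpha,\beta)\in P(n)$, $x\in NG_{n-\#\alpha}$, $y\in NG_{n-\#\beta}$. **Theorem.** For every $n>1$, $$NG_n\cap D_n=N_n\cap D_n,\qquad\text{and consequently}\qquad \partial_n(N_n\cap D_n)=\partial_n(NG_n\cap D_n).$$ Both equalities also hold when $N_n$ is generated only by those $F_{\alpha,\beta}(x,y)$ with $(\alpha,\beta)\in P(n)$ for which $\alpha$ and $\beta$ are both non-empty. -/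

import Mathlib

open CategoryTheory Simplicial

universe u

namespace SimplicialGroup

/-- The face homomorphism `d_i : G_{n+1} → G_n` of a simplicial group. -/
def d (G : SimplicialObject GrpCat.{u}) {n : ℕ} (i : Fin (n + 2)) : G _⦋n + 1⦌ →* G _⦋n⦌ :=
  (G.δ i).hom

/-- The degeneracy homomorphism `s_i : G_n → G_{n+1}` of a simplicial group. -/
def s (G : SimplicialObject GrpCat.{u}) {n : ℕ} (i : Fin (n + 1)) : G _⦋n⦌ →* G _⦋n + 1⦌ :=
  (G.σ i).hom

/-- The term `NG_n = ⋂_{i < n} Ker d_i` of the Moore complex (all faces but the last one),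
with `NG_0 = G_0`. -/
def NG (G : SimplicialObject GrpCat.{u}) (n : ℕ) : Subgroup (G _⦋n⦌) :=
  match n with
  | 0 => ⊤
  | k + 1 => ⨅ i : Fin (k + 1), (d G i.castSucc).ker

theorem mem_NG_succ (G : SimplicialObject GrpCat.{u}) {n : ℕ} (x : G _⦋n + 1⦌) :
    x ∈ NG G (n + 1) ↔ ∀ i : Fin (n + 1), d G i.castSucc x = 1 := by
  simp [NG, Subgroup.mem_iInf, MonoidHom.mem_ker]

theorem d_d (G : SimplicialObject GrpCat.{u}) {n : ℕ} {i j : Fin (n + 2)} (h : i ≤ j)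
    (x : G _⦋n + 2⦌) : d G i (d G j.succ x) = d G j (d G i.castSucc x) :=
  ConcreteCategory.congr_hom (G.δ_comp_δ h) x

theorem d_s_self (G : SimplicialObject GrpCat.{u}) {n : ℕ} (i : Fin (n + 1))
    (x : G _⦋n⦌) : d G i.castSucc (s G i x) = x :=
  ConcreteCategory.congr_hom (G.δ_comp_σ_self (i := i)) x

theorem d_s_of_le (G : SimplicialObject GrpCat.{u}) {n : ℕ} {i : Fin (n + 2)} {j : Fin (n + 1)}
    (h : i ≤ j.castSucc) (x : G _⦋n + 1⦌) :
    d G i.castSucc (s G j.succ x) = s G j (d G i x) :=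
  ConcreteCategory.congr_hom (G.δ_comp_σ_of_le h) x

/-- The last face maps `NG_{n+1}` into `NG_n`. -/
theorem d_last_mem (G : SimplicialObject GrpCat.{u}) {n : ℕ} {x : G _⦋n + 1⦌}
    (hx : x ∈ NG G (n + 1)) : d G (Fin.last (n + 1)) x ∈ NG G n := by
  cases n with
  | zero => exact Subgroup.mem_top _
  | succ k =>
    rw [mem_NG_succ] at hx ⊢
    intro i
    rw [← Fin.succ_last, d_d G (Fin.le_last _), hx, map_one]

/-- The boundary `∂_n : NG_n → NG_{n-1}` of the Moore complex, the restriction of the last face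
`d_n`, for `n ≥ 1` (and the trivial map for `n = 0`, where no boundary is defined). -/
def boundary (G : SimplicialObject GrpCat.{u}) (n : ℕ) : NG G n →* NG G (n - 1) :=
  match n with
  | 0 => 1
  | k + 1 =>
    ((d G (Fin.last (k + 1))).comp (NG G (k + 1)).subtype).codRestrict (NG G k)
      fun x => d_last_mem G x.2

/-- `D_n`, the subgroup of `G_n` generated by the degenerate elements `s_i y`, `y ∈ G_{n-1}`
(there are none for `n = 0`). -/
def D (G : SimplicialObject GrpCat.{u}) (n : ℕ) : Subgroup (G _⦋n⦌) :=
  match n with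
  | 0 => ⊥
  | k + 1 => Subgroup.closure {x | ∃ (i : Fin (k + 1)) (y : G _⦋k⦌), x = s G i y}

/-- The map `p_j(z) = z · (s_j d_j z)⁻¹` on `G_{n+1}`, for `0 ≤ j ≤ n`. -/
def pj (G : SimplicialObject GrpCat.{u}) {n : ℕ} (j : Fin (n + 1)) (z : G _⦋n + 1⦌) :
    G _⦋n + 1⦌ :=
  z * (s G j (d G j.castSucc z))⁻¹

/-- The composite `p_n ⋯ p_1 p_0` on `G_{n+1}` (`p_0` is applied first), as a map to `G_{n+1}`. -/
def pComp (G : SimplicialObject GrpCat.{u}) {n : ℕ} (z : G _⦋n + 1⦌) : G _⦋n + 1⦌ :=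
  Fin.foldl (n + 1) (fun w j => pj G j w) z

theorem d_pj_self (G : SimplicialObject GrpCat.{u}) {n : ℕ} (j : Fin (n + 1))
    (z : G _⦋n + 1⦌) : d G j.castSucc (pj G j z) = 1 := by
  simp [pj, d_s_self]

theorem d_pj_of_lt (G : SimplicialObject GrpCat.{u}) {n : ℕ} {i j : Fin (n + 1)} (h : i < j)
    (z : G _⦋n + 1⦌) (hz : d G i.castSucc z = 1) : d G i.castSucc (pj G j z) = 1 := by
  cases n with
  | zero => exact absurd h (by omega)
  | succ k =>
    obtain ⟨j, rfl⟩ := Fin.exists_succ_eq.2 (Fin.ne_zero_of_lt h)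
    have hij : i ≤ j.castSucc := Fin.le_castSucc_iff.2 h
    rw [pj, map_mul, hz, map_inv, d_s_of_le G hij, ← Fin.succ_castSucc, d_d G hij, hz]
    simp

theorem pComp_mem (G : SimplicialObject GrpCat.{u}) {n : ℕ} (z : G _⦋n + 1⦌) :
    pComp G z ∈ NG G (n + 1) := by
  have key : ∀ (m : ℕ) (hm : m ≤ n + 1) (i : Fin (n + 1)), i.1 < m →
      d G i.castSucc (Fin.foldl m (fun w j => pj G (Fin.castLE hm j) w) z) = 1 := by
    intro m
    induction m with
    | zero => intro _ i hi; omega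
    | succ m ih =>
      intro hm i hi
      rw [Fin.foldl_succ_last]
      by_cases h : i.1 = m
      · have : i = Fin.castLE hm (Fin.last m) := Fin.ext h
        rw [this]
        exact d_pj_self G _ _
      · exact d_pj_of_lt G (Fin.lt_def.2 (by simp; omega)) _ (ih (by omega) i (by omega))
  rw [mem_NG_succ]
  intro i
  exact key (n + 1) le_rfl i i.2

/-- The projection `p = p_{n-1} ⋯ p_1 p_0 : G_n → NG_n` (the identity for `n = 0`). -/
def p (G : SimplicialObject GrpCat.{u}) {n : ℕ} (z : G _⦋n⦌) : NG G n :=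
  match n, z with
  | 0, z => ⟨z, Subgroup.mem_top z⟩
  | _ + 1, z => ⟨pComp G z, pComp_mem G z⟩

/-- The set `S(n)` of monotone surjective maps `[n] → [m]`, for all `m`. -/
structure S (n : ℕ) where
  /-- The target dimension, which is `n - #α`. -/
  tgt : ℕ
  /-- The monotone map. -/
  map : ⦋n⦌ ⟶ ⦋tgt⦌
  surj : Function.Surjective map.toOrderHom

/-- The set of indices `{i : α(i) = α(i+1)} = {i_1 < ⋯ < i_l}` with which `α` is identified. -/
def S.indices {n : ℕ} (α : S n) : Finset (Fin n) :=
  Finset.univ.filter fun i => α.map.toOrderHom i.castSucc = α.map.toOrderHom i.succ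

/-- The strict lexicographic order on `S(n)`: with `i_1 < ⋯ < i_l` the indices of `α` and
`j_1 < ⋯ < j_m` those of `β`, one has `β < α` if `i_{k+1} < j_{k+1}` at the first place where the
two sequences differ, or if the sequence of `β` is a proper initial segment of that of `α`. -/
def S.lt {n : ℕ} (β α : S n) : Prop :=
  List.Lex (fun j i : Fin n => i < j) (β.indices.sort (· ≤ ·)) (α.indices.sort (· ≤ ·))

/-- The homomorphism `s_α = s_{i_l} ⋯ s_{i_1} : G_{n-#α} → G_n` induced by `α ∈ S(n)`. -/
def sα (G : SimplicialObject GrpCat.{u}) {n : ℕ} (α : S n) : G _⦋α.tgt⦌ →* G _⦋n⦌ :=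
  (G.map α.map.op).hom

/-- The set `P(n)` of pairs `(α, β)` in `S(n)` with `α ∩ β = ∅` and `β < α`. -/
def P (n : ℕ) : Set (S n × S n) :=
  {q | q.1.indices ∩ q.2.indices = ∅ ∧ q.2.lt q.1}

/-- The pairs of `P(n)` in which neither index is the empty one (the identity of `[n]`). -/
def Pne (n : ℕ) : Set (S n × S n) :=
  {q | q ∈ P n ∧ q.1.indices.Nonempty ∧ q.2.indices.Nonempty}

open scoped commutatorElement in
/-- The Peiffer pairing `F_{α,β}(x, y) = p [s_α x, s_β y]`, with `[a, b] = a b a⁻¹ b⁻¹`. -/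
def F (G : SimplicialObject GrpCat.{u}) {n : ℕ} (α β : S n)
    (x : NG G α.tgt) (y : NG G β.tgt) : NG G n :=
  p G ⁅sα G α (x : G _⦋α.tgt⦌), sα G β (y : G _⦋β.tgt⦌)⁆

/-- The normal subgroup of `G_n` generated by the elements `F_{α,β}(x, y)` with `(α, β)` in the
set `Q` of pairs. -/
def N (G : SimplicialObject GrpCat.{u}) (n : ℕ) (Q : Set (S n × S n)) : Subgroup (G _⦋n⦌) :=
  Subgroup.normalClosure
    {g | ∃ (α β : S n) (_ : (α, β) ∈ Q) (x : NG G α.tgt) (y : NG G β.tgt),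
      g = (F G α β x y : G _⦋n⦌)}

end SimplicialGroup

open SimplicialGroup

namespace SimplicialGroup

variable (G : SimplicialObject GrpCat.{u})

/-! Only `NG ⊓ D ≤ N` needs work. Put `H_i = N · ⟨s_α x : x ∈ NG, α ≠ ∅, min α ≥ i⟩`. Then `D_n ≤
H_0` and `H_n = N`, so it suffices to show `H_i ∩ NG ≤ H_{i+1}` for each `i < n`. The generators
with `min α = i` lie in the image of `s_i` and normalise `H_{i+1}` (`closure_le_normalizer`), so
each `g ∈ H_i` is `h * s_i b` with `h ∈ H_{i+1}`. The face `d_i` kills `h`; if `g ∈ NG` it also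
kills `g`, hence `b = 1`. Normalisation rests on `commutator_mem`: `w = [s_α x, s_β y]` is killed by
`d_0, …, d_i`. If `α` and `β` are disjoint, `p w` is a generator of `N`, and it differs from `w`
only by degenerate elements with the same vanishing faces. By `kerFaces_le_closure_gen` these are
products of elements `s_γ z` with `min γ > i`. -/

/-- The common kernel in `G_n` of the faces `d_k` with `k < i` and `k < n`. -/
def kerFaces (n i : ℕ) : Subgroup (G _⦋n⦌) :=
  match n with
  | 0 => ⊤
  | m + 1 => ⨅ k : Fin (m + 1), ⨅ _ : k.1 < i, (d G k.castSucc).ker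

/-- The elements `s_α x` with `x` in the Moore complex and all indices of `α` at least `i`. -/
def gen (n i : ℕ) : Set (G _⦋n⦌) :=
  {g | ∃ (α : S n) (x : NG G α.tgt), (∀ k ∈ α.indices, i ≤ k.1) ∧ g = sα G α x}

/-- The elements `s_α x` of `gen G n i` with `α` non-empty. -/
def degGen (n i : ℕ) : Set (G _⦋n⦌) :=
  {g | ∃ (α : S n) (x : NG G α.tgt),
    (∀ k ∈ α.indices, i ≤ k.1) ∧ α.indices.Nonempty ∧ g = sα G α x}

variable {G}

/-! ### Common kernels of the first faces -/

theorem mem_kerFaces_succ {n i : ℕ} {x : G _⦋n + 1⦌} :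
    x ∈ kerFaces G (n + 1) i ↔ ∀ k : Fin (n + 1), k.1 < i → d G k.castSucc x = 1 := by
  simp [kerFaces, Subgroup.mem_iInf, MonoidHom.mem_ker]

instance kerFaces_normal (n i : ℕ) : (kerFaces G n i).Normal := by
  cases n with
  | zero => exact inferInstanceAs (⊤ : Subgroup _).Normal
  | succ n =>
    exact Subgroup.normal_iInf_normal fun k => Subgroup.normal_iInf_normal fun _ => inferInstance

theorem kerFaces_self (n : ℕ) : kerFaces G n n = NG G n := by
  cases n with
  | zero => rfl
  | succ n =>
    ext x
    rw [mem_kerFaces_succ, mem_NG_succ]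
    exact ⟨fun h k => h k k.2, fun h k _ => h k⟩

instance NG_normal (n : ℕ) : (NG G n).Normal := kerFaces_self (G := G) n ▸ kerFaces_normal n n

theorem kerFaces_anti (n : ℕ) {i j : ℕ} (h : i ≤ j) : kerFaces G n j ≤ kerFaces G n i := by
  cases n with
  | zero => exact le_rfl
  | succ n => exact fun x hx => mem_kerFaces_succ.2 fun k hk =>
      mem_kerFaces_succ.1 hx k (hk.trans_le h)

theorem NG_le_kerFaces (n i : ℕ) : NG G n ≤ kerFaces G n i := by
  cases n with
  | zero => exact le_rfl
  | succ n => exact fun x hx => mem_kerFaces_succ.2 fun k _ => (mem_NG_succ G x).1 hx k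

theorem kerFaces_zero (n : ℕ) : kerFaces G n 0 = ⊤ := by
  cases n with
  | zero => rfl
  | succ n => ext x; simp [mem_kerFaces_succ]

theorem degGen_subset_gen (n i : ℕ) : degGen G n i ⊆ gen G n i :=
  fun _ ⟨α, x, h, _, e⟩ => ⟨α, x, h, e⟩

theorem gen_anti (n : ℕ) {i j : ℕ} (h : i ≤ j) : gen G n j ⊆ gen G n i :=
  fun _ ⟨α, x, hα, e⟩ => ⟨α, x, fun k hk => h.trans (hα k hk), e⟩

theorem d_mem_kerFaces {n i : ℕ} {j : Fin (n + 1)} (h : i ≤ j) {z : G _⦋n + 1⦌}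
    (hz : z ∈ kerFaces G (n + 1) i) : d G j.castSucc z ∈ kerFaces G n i := by
  cases n with
  | zero => exact Subgroup.mem_top _
  | succ n =>
    refine mem_kerFaces_succ.2 fun k hk => ?_
    obtain ⟨j, rfl⟩ := Fin.exists_succ_eq.2 (show j ≠ 0 by rintro rfl; simp at h; omega)
    rw [← Fin.succ_castSucc, d_d G (Fin.le_def.2 (by simp at h ⊢; omega)),
      mem_kerFaces_succ.1 hz k.castSucc hk, map_one]

/-! ### Iterated degeneracies of Moore elements -/

theorem mem_indices {n : ℕ} (α : S n) (k : Fin n) :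
    k ∈ α.indices ↔ α.map.toOrderHom k.castSucc = α.map.toOrderHom k.succ := by
  simp [S.indices]

/-- The identity of `[n]`, whose set of indices is empty. -/
def S.id (n : ℕ) : S n := ⟨n, 𝟙 _, fun x => ⟨x, rfl⟩⟩

theorem NG_subset_gen (n i : ℕ) : (NG G n : Set (G _⦋n⦌)) ⊆ gen G n i := by
  intro x hx
  refine ⟨S.id n, ⟨x, hx⟩, fun k hk => ?_, ?_⟩
  · rw [mem_indices] at hk
    exact absurd hk (Fin.castSucc_lt_succ (i := k)).ne
  · simp only [sα, S.id, op_id, G.map_id]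
    rfl

/-- Applying a degeneracy `s_j` to `s_α x` gives `s_{α ∘ σ_j} x`. -/
theorem s_mem_degGen {n i : ℕ} {j : Fin (n + 1)} (h : i ≤ j) {g : G _⦋n⦌} (hg : g ∈ gen G n i) :
    s G j g ∈ degGen G (n + 1) i := by
  obtain ⟨α, x, hα, rfl⟩ := hg
  have key : ∀ k, (SimplexCategory.σ j ≫ α.map).toOrderHom k
      = α.map.toOrderHom (j.predAbove k) := fun _ => rfl
  refine ⟨⟨α.tgt, SimplexCategory.σ j ≫ α.map, ?_⟩, x, ?_, ⟨j, ?_⟩, ?_⟩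
  · intro y
    obtain ⟨z, rfl⟩ := α.surj y
    exact ⟨j.castSucc.succAbove z, by rw [key]; simp⟩
  · intro k hk
    rw [mem_indices] at hk
    -- `σ_j` fixes all vertices up to `j`, so an index `k < j` of the composite is already an index
    -- of `α`.
    by_contra! hki
    have hkj : k.1 < j.1 := hki.trans_le h
    have hkn : k.1 < n := by omega
    change α.map.toOrderHom (j.predAbove k.castSucc) = α.map.toOrderHom (j.predAbove k.succ) at hk
    have h1 : j.predAbove k.castSucc = (⟨k, hkn⟩ : Fin n).castSucc := by
      rw [Fin.predAbove_of_le_castSucc _ _ (Fin.le_def.2 (by simp; omega))]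
      ext; simp
    have h2 : j.predAbove k.succ = (⟨k, hkn⟩ : Fin n).succ := by
      rw [Fin.predAbove_of_le_castSucc _ _ (Fin.le_def.2 (by simp; omega))]
      ext; simp
    rw [h1, h2] at hk
    exact absurd (hα ⟨k, hkn⟩ ((mem_indices _ _).2 hk)) (by simpa using hki)
  · rw [mem_indices]
    change α.map.toOrderHom (j.predAbove j.castSucc) = α.map.toOrderHom (j.predAbove j.succ)
    simp
  · simp [sα, s, SimplicialObject.σ]

/-- If `j` is an index of `α`, then `s_α x` lies in the image of `s_j`. -/
theorem sα_mem_range {n : ℕ} {α : S (n + 1)} {j : Fin (n + 1)} (h : j ∈ α.indices)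
    (x : G _⦋α.tgt⦌) : sα G α x ∈ (s G j).range := by
  rw [mem_indices] at h
  obtain ⟨θ, hθ⟩ := SimplexCategory.eq_σ_comp_of_not_injective' α.map j h
  exact ⟨G.map θ.op x, by simp [sα, s, SimplicialObject.σ, hθ]⟩

/-- For `k < i` neither `k` nor any smaller number is an index of `α`, so `α` takes the value `α(k)`
only at `k`. Thus `δ_k ≫ α` misses this value and factors through `δ_c`, `c = α(k)`. As `c` is not
the last vertex, `d_c` kills `x`. -/
theorem gen_subset_kerFaces (n i : ℕ) : gen G n i ⊆ kerFaces G n i := by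
  rintro _ ⟨⟨m, f, hf⟩, ⟨x, hx⟩, hα, rfl⟩
  cases n with
  | zero => exact Subgroup.mem_top _
  | succ n =>
    refine mem_kerFaces_succ.2 fun k hk => ?_
    have hlt : ∀ l : Fin (n + 1), l.1 < i → f.toOrderHom l.castSucc < f.toOrderHom l.succ := by
      intro l hl
      refine lt_of_le_of_ne (f.toOrderHom.monotone (Fin.castSucc_lt_succ).le) fun e => ?_
      exact absurd (hα l ((mem_indices _ _).2 e)) (by omega)
    cases m with
    | zero =>
      exact absurd (Subsingleton.elim (α := Fin 1) _ _) (hlt k hk).ne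
    | succ m =>
      obtain ⟨c, hc⟩ := Fin.exists_castSucc_eq.2 ((hlt k hk).trans_le (Fin.le_last _)).ne
      have hmiss : ∀ y, (SimplexCategory.δ k.castSucc ≫ f).toOrderHom y ≠ c.castSucc := by
        intro y
        change f.toOrderHom (k.castSucc.succAbove y) ≠ _
        rw [hc]
        rcases lt_or_gt_of_ne (Fin.succAbove_ne k.castSucc y) with hy | hy
        · obtain ⟨l, rfl⟩ := Fin.exists_succ_eq.2
            (show k ≠ 0 by rintro rfl; exact absurd hy (by simp))
          refine ((f.toOrderHom.monotone ?_).trans_lt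
            (hlt l.castSucc (by simp at hk ⊢; omega))).ne
          rw [Fin.lt_def] at hy
          rw [Fin.le_def]
          simp at hy ⊢
          omega
        · refine ((hlt k hk).trans_le (f.toOrderHom.monotone ?_)).ne'
          rw [Fin.lt_def] at hy
          rw [Fin.le_def]
          simp at hy ⊢
          omega
      obtain ⟨θ, hθ⟩ := SimplexCategory.eq_comp_δ_of_not_surjective' _ _ hmiss
      have e : d G k.castSucc (sα G ⟨m + 1, f, hf⟩ x) = G.map θ.op (d G c.castSucc x) := by
        have := congrArg (fun φ => (G.map φ.op).hom x) hθ
        simpa [sα, d, SimplicialObject.δ] using this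
      rw [e, (mem_NG_succ G x).1 hx]
      exact map_one (G.map θ.op).hom

/-! ### Generation of the kernels, and the effect of `p` -/

theorem s_mem_closure_degGen {n i : ℕ} {j : Fin (n + 1)} (h : i ≤ j) {g : G _⦋n⦌}
    (hg : g ∈ Subgroup.closure (gen G n i)) :
    s G j g ∈ Subgroup.closure (degGen G (n + 1) i) := by
  have : Subgroup.closure (gen G n i) ≤ (Subgroup.closure (degGen G (n + 1) i)).comap (s G j) :=
    (Subgroup.closure_le _).2 fun x hx => Subgroup.subset_closure (s_mem_degGen h hx)
  exact this hg

theorem pj_mem_kerFaces_succ {n : ℕ} (j : Fin (n + 1)) {z : G _⦋n + 1⦌}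
    (hz : z ∈ kerFaces G (n + 1) j) : pj G j z ∈ kerFaces G (n + 1) (j + 1) := by
  refine mem_kerFaces_succ.2 fun k hk => ?_
  rcases Nat.lt_succ_iff_lt_or_eq.1 hk with hk | hk
  · exact d_pj_of_lt G hk z (mem_kerFaces_succ.1 hz k hk)
  · obtain rfl : k = j := Fin.ext hk
    exact d_pj_self G _ _

/-- The common kernel of the first `i` faces is generated by the `s_α x` it contains. -/
theorem kerFaces_le_closure_gen (n i : ℕ) :
    kerFaces G n i ≤ Subgroup.closure (gen G n i) := by
  induction n generalizing i with
  | zero => exact fun x _ => Subgroup.subset_closure (NG_subset_gen 0 i (Subgroup.mem_top x))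
  | succ n ih =>
    rcases le_or_gt (n + 1) i with h | h
    · exact (kerFaces_anti _ h).trans ((kerFaces_self (G := G) (n + 1)).le.trans
        fun x hx => Subgroup.subset_closure (NG_subset_gen _ _ hx))
    -- Write `z = p_i(z) * s_i d_i z`: the first factor is killed by one more face (descending
    -- induction on `i`), the second comes from dimension `n` (outer induction).
    · induction h.le using Nat.decreasingInduction with
      | self => exact absurd h (lt_irrefl _)
      | of_succ i hi ih' =>
        intro z hz
        let j : Fin (n + 1) := ⟨i, h⟩
        have h1 : pj G j z ∈ Subgroup.closure (gen G (n + 1) (i + 1)) := by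
          have h2 : pj G j z ∈ kerFaces G (n + 1) (i + 1) := pj_mem_kerFaces_succ j hz
          rcases Nat.lt_or_ge (i + 1) (n + 1) with h' | h'
          · exact ih' h' h2
          · exact Subgroup.subset_closure (NG_subset_gen _ _
              (kerFaces_self (G := G) (n + 1) ▸ kerFaces_anti _ h' h2))
        have h3 : s G j (d G j.castSucc z) ∈ Subgroup.closure (degGen G (n + 1) i) :=
          have hij : i ≤ j.1 := le_rfl
          s_mem_closure_degGen hij (ih i (d_mem_kerFaces hij hz))
        have h4 : pj G j z * s G j (d G j.castSucc z) = z := inv_mul_cancel_right _ _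
        have h5 : pj G j z ∈ Subgroup.closure (gen G (n + 1) i) :=
          Subgroup.closure_mono (gen_anti (n + 1) (Nat.le_succ i)) h1
        have h6 : s G j (d G j.castSucc z) ∈ Subgroup.closure (gen G (n + 1) i) :=
          Subgroup.closure_mono (degGen_subset_gen (n + 1) i) h3
        exact h4 ▸ mul_mem h5 h6

theorem s_d_mem_closure_degGen {n i : ℕ} {z : G _⦋n + 1⦌} (hz : z ∈ kerFaces G (n + 1) i)
    (j : Fin (n + 1)) : s G j (d G j.castSucc z) ∈ Subgroup.closure (degGen G (n + 1) i) := by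
  rcases lt_or_ge j.1 i with h | h
  · rw [mem_kerFaces_succ.1 hz j h, map_one]
    exact one_mem _
  · exact s_mem_closure_degGen h (kerFaces_le_closure_gen n i (d_mem_kerFaces h hz))

theorem closure_degGen_le_kerFaces (n i : ℕ) :
    Subgroup.closure (degGen G n i) ≤ kerFaces G n i :=
  (Subgroup.closure_le _).2 ((degGen_subset_gen n i).trans (gen_subset_kerFaces n i))

/-- On the common kernel of the first `i` faces, `p` changes an element only by degenerate
elements from the same kernel. -/
theorem inv_mul_p_mem {n i : ℕ} {z : G _⦋n + 1⦌} (hz : z ∈ kerFaces G (n + 1) i) :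
    z⁻¹ * p G z ∈ Subgroup.closure (degGen G (n + 1) i) := by
  -- The order of the factors `p_j` is irrelevant here: each one multiplies by some `(s_j d_j w)⁻¹`
  -- and keeps `w` in the kernel.
  have key : ∀ (m : ℕ) (f : Fin m → Fin (n + 1)),
      z⁻¹ * Fin.foldl m (fun w j => pj G (f j) w) z ∈
        Subgroup.closure (degGen G (n + 1) i) := by
    intro m
    induction m with
    | zero => intro f; simp
    | succ m ih =>
      intro f
      rw [Fin.foldl_succ_last]
      have h1 := ih fun j => f j.castSucc
      set w := Fin.foldl m (fun w j => pj G (f j.castSucc) w) z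
      have hw : w ∈ kerFaces G (n + 1) i := by
        simpa using mul_mem hz (closure_degGen_le_kerFaces _ _ h1)
      rw [pj, ← mul_assoc]
      exact mul_mem h1 (inv_mem (s_d_mem_closure_degGen hw _))
  exact key (n + 1) fun j => j

/-! ### Commutators modulo `N` -/

/-- The first entries decide the order: `min α ≤ i < min β`, and the sequence with the larger first
entry is the smaller one. -/
theorem mem_Pne {n i : ℕ} {α β : S n} (hα : ∃ k ∈ α.indices, k.1 ≤ i)
    (hβ : ∀ k ∈ β.indices, i < k.1) (hne : β.indices.Nonempty)
    (hd : α.indices ∩ β.indices = ∅) : (α, β) ∈ Pne n := by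
  obtain ⟨k, hk, hki⟩ := hα
  refine ⟨⟨hd, ?_⟩, ⟨k, hk⟩, hne⟩
  have ha := α.indices.pairwise_sort (· ≤ ·)
  have hmemα : k ∈ α.indices.sort (· ≤ ·) := (Finset.mem_sort _).2 hk
  have hmemβ : ∀ l ∈ β.indices.sort (· ≤ ·), i < l.1 :=
    fun l hl => hβ l ((Finset.mem_sort _).1 hl)
  have hb : β.indices.sort (· ≤ ·) ≠ [] := by
    obtain ⟨l, hl⟩ := hne
    exact List.ne_nil_of_mem ((Finset.mem_sort (· ≤ ·)).2 hl)
  unfold S.lt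
  generalize α.indices.sort (· ≤ ·) = L at *
  generalize β.indices.sort (· ≤ ·) = M at *
  cases L with
  | nil => simp at hmemα
  | cons a L =>
    cases M with
    | nil => exact absurd rfl hb
    | cons b M =>
      refine List.Lex.rel (Fin.lt_def.2 ?_)
      have hak : a ≤ k := by
        rcases List.mem_cons.1 hmemα with rfl | h
        · exact le_rfl
        · exact List.rel_of_pairwise_cons ha h
      have := hmemβ b (by simp)
      rw [Fin.le_def] at hak
      omega

theorem N_le_NG (n : ℕ) (Q : Set (S n × S n)) : N G n Q ≤ NG G n :=
  Subgroup.normalClosure_le_normal (by rintro _ ⟨α, β, _, x, y, rfl⟩; exact (F G α β x y).2)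

theorem D_le_closure_degGen (n : ℕ) : D G (n + 1) ≤ Subgroup.closure (degGen G (n + 1) 0) := by
  refine (Subgroup.closure_le _).2 ?_
  rintro _ ⟨i, y, rfl⟩
  exact s_mem_closure_degGen (Nat.zero_le _)
    (kerFaces_le_closure_gen n 0 (kerFaces_zero (G := G) n ▸ Subgroup.mem_top y))

open scoped commutatorElement in
/-- Modulo `N`, the commutator of `s_α x` and `s_β y` with `min α ≤ i < min β` is a product of
degenerate elements `s_γ z` with `i < min γ`, provided it is killed by the faces up to `d_i`. -/
theorem commutator_mem {n i : ℕ} {Q : Set (S (n + 1) × S (n + 1))} (hQ : Pne (n + 1) ⊆ Q)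
    {α β : S (n + 1)} (x : NG G α.tgt) (y : NG G β.tgt) (hα : ∃ k ∈ α.indices, k.1 ≤ i)
    (hβ : ∀ k ∈ β.indices, i + 1 ≤ k.1) (hne : β.indices.Nonempty) :
    ⁅sα G α x, sα G β y⁆ ∈ N G (n + 1) Q ⊔ Subgroup.closure (degGen G (n + 1) (i + 1)) := by
  have hb : sα G β y ∈ kerFaces G (n + 1) (i + 1) :=
    gen_subset_kerFaces _ _ ⟨β, y, hβ, rfl⟩
  have hw : ⁅sα G α (x : G _⦋α.tgt⦌), sα G β (y : G _⦋β.tgt⦌)⁆ ∈ kerFaces G (n + 1) (i + 1) :=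
    mul_mem ((kerFaces_normal _ _).conj_mem _ hb _) (inv_mem hb)
  rcases Finset.eq_empty_or_nonempty (α.indices ∩ β.indices) with hd | ⟨j, hj⟩
  · have hp : (p G ⁅sα G α (x : G _⦋α.tgt⦌), sα G β (y : G _⦋β.tgt⦌)⁆ : G _⦋n + 1⦌) ∈
        N G (n + 1) Q :=
      Subgroup.subset_normalClosure ⟨α, β, hQ (mem_Pne hα hβ hne hd), x, y, rfl⟩
    have := mul_mem (Subgroup.mem_sup_left hp)
      (Subgroup.mem_sup_right (inv_mem (inv_mul_p_mem hw)) : _ ∈ N G (n + 1) Q ⊔ _)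
    simpa using this
  · rw [Finset.mem_inter] at hj
    obtain ⟨a, ha⟩ := sα_mem_range hj.1 (x : G _⦋α.tgt⦌)
    obtain ⟨b, hb⟩ := sα_mem_range hj.2 (y : G _⦋β.tgt⦌)
    -- With a common index `j`, both entries lie in the image of `s_j`, so `w = s_j d_j w` and `N`
    -- is not needed.
    have h := s_d_mem_closure_degGen hw j
    rw [← ha, ← hb, ← map_commutatorElement, d_s_self, map_commutatorElement, ha, hb] at h
    exact Subgroup.mem_sup_right h

/-- The elements `s_α x` with `min α = i` normalise the subgroup generated by `N` and the
degenerate elements `s_β y` with `i < min β`. -/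
theorem closure_le_normalizer {n i : ℕ} {Q : Set (S (n + 1) × S (n + 1))}
    (hQ : Pne (n + 1) ⊆ Q) :
    Subgroup.closure {g : G _⦋n + 1⦌ | ∃ (α : S (n + 1)) (x : NG G α.tgt),
        (∃ k ∈ α.indices, k.1 = i) ∧ g = sα G α x} ≤
      Subgroup.normalizer
        (N G (n + 1) Q ⊔ Subgroup.closure (degGen G (n + 1) (i + 1)) : Subgroup _) := by
  set H := N G (n + 1) Q ⊔ Subgroup.closure (degGen G (n + 1) (i + 1))
  have hN : (N G (n + 1) Q).Normal := Subgroup.normalClosure_normal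
  have key : ∀ (α : S (n + 1)) (x : NG G α.tgt), (∃ k ∈ α.indices, k.1 = i) →
      H ≤ H.comap (MulAut.conj (sα G α (x : G _⦋α.tgt⦌))).toMonoidHom := by
    rintro α x ⟨k, hk, hki⟩
    refine sup_le (fun g hg => Subgroup.mem_sup_left (hN.conj_mem g hg _))
      ((Subgroup.closure_le _).2 ?_)
    rintro _ ⟨β, y, hβ, hne, rfl⟩
    have := mul_mem (commutator_mem hQ x y ⟨k, hk, hki.le⟩ hβ hne)
      (Subgroup.mem_sup_right (Subgroup.subset_closure ⟨β, y, hβ, hne, rfl⟩) :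
        sα G β (y : G _⦋β.tgt⦌) ∈ H)
    simpa [commutatorElement_def] using this
  refine (Subgroup.closure_le _).2 ?_
  rintro _ ⟨α, x, hα, rfl⟩
  refine Subgroup.mem_normalizer_iff.2 fun h => ⟨fun hh => key α x hα hh, fun hh => ?_⟩
  -- Conjugating by `s_α (x⁻¹) = (s_α x)⁻¹` gives the reverse inclusion.
  have := key α x⁻¹ hα hh
  simpa [mul_assoc] using this

/-! ### Descent along the filtration -/

theorem sup_inf_NG_le {n : ℕ} {Q : Set (S (n + 1) × S (n + 1))} (hQ : Pne (n + 1) ⊆ Q)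
    {i : ℕ} (hi : i ≤ n + 1) :
    (N G (n + 1) Q ⊔ Subgroup.closure (degGen G (n + 1) i)) ⊓ NG G (n + 1) ≤
      N G (n + 1) Q := by
  induction hi using Nat.decreasingInduction with
  | self =>
    have : degGen G (n + 1) (n + 1) = ∅ := by
      ext g
      simp only [Set.mem_empty_iff_false, iff_false]
      rintro ⟨α, x, hα, ⟨k, hk⟩, _⟩
      exact absurd (hα k hk) (by omega)
    simp [this]
  | of_succ i hi ih =>
    set A : Set (G _⦋n + 1⦌) := {g | ∃ (α : S (n + 1)) (x : NG G α.tgt),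
      (∃ k ∈ α.indices, k.1 = i) ∧ g = sα G α x}
    set H := N G (n + 1) Q ⊔ Subgroup.closure (degGen G (n + 1) (i + 1))
    have hHK : H ≤ kerFaces G (n + 1) (i + 1) :=
      sup_le ((N_le_NG _ _).trans (NG_le_kerFaces _ _)) (closure_degGen_le_kerFaces _ _)
    have hle : N G (n + 1) Q ⊔ Subgroup.closure (degGen G (n + 1) i) ≤
        H ⊔ Subgroup.closure A := by
      refine sup_le (le_sup_left.trans le_sup_left) ((Subgroup.closure_le _).2 ?_)
      rintro _ ⟨α, x, hα, hne, rfl⟩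
      by_cases h : ∃ k ∈ α.indices, k.1 = i
      · exact Subgroup.mem_sup_right (Subgroup.subset_closure ⟨α, x, h, rfl⟩)
      · push Not at h
        exact Subgroup.mem_sup_left (Subgroup.mem_sup_right (Subgroup.subset_closure
          ⟨α, x, fun k hk => lt_of_le_of_ne (hα k hk) (h k hk).symm, hne, rfl⟩))
    have hA : Subgroup.closure A ≤ (s G (⟨i, hi⟩ : Fin (n + 1))).range := by
      refine (Subgroup.closure_le _).2 ?_
      rintro _ ⟨α, x, ⟨k, hk, rfl⟩, rfl⟩
      exact sα_mem_range hk _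
    rintro g ⟨hg, hgN⟩
    have hg' : g ∈ ((H ⊔ Subgroup.closure A : Subgroup _) : Set (G _⦋n + 1⦌)) := hle hg
    -- Normalisation turns the join into a product of sets, which yields `g = h * s_i b`.
    rw [Subgroup.coe_mul_of_right_le_normalizer_left _ _ (closure_le_normalizer hQ)] at hg'
    obtain ⟨h, hh, a, ha, rfl⟩ := hg'
    obtain ⟨b, rfl⟩ := hA ha
    have h1 := (mem_NG_succ G _).1 hgN ⟨i, hi⟩
    have h2 := mem_kerFaces_succ.1 (hHK hh) ⟨i, hi⟩ (Nat.lt_succ_self i)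
    have hb : b = 1 := by simpa only [map_mul, h2, one_mul, d_s_self] using h1
    subst hb
    refine ih ⟨?_, hgN⟩
    simpa using hh

/-- The degenerate part of the Moore complex is that of the normal subgroup generated by the
Peiffer pairings indexed by any set of pairs containing those with both indices non-empty. -/
theorem NG_inf_D_eq {n : ℕ} {Q : Set (S (n + 1) × S (n + 1))} (hQ : Pne (n + 1) ⊆ Q) :
    NG G (n + 1) ⊓ D G (n + 1) = N G (n + 1) Q ⊓ D G (n + 1) := by
  refine le_antisymm (fun g hg => ⟨?_, hg.2⟩) (inf_le_inf_right _ (N_le_NG _ _))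
  exact sup_inf_NG_le hQ (Nat.zero_le _)
    ⟨Subgroup.mem_sup_right (D_le_closure_degGen n hg.2), hg.1⟩

end SimplicialGroup

theorem theorem2p1 (G : SimplicialObject GrpCat.{u}) (n : ℕ) (hn : 1 < n) :
    (NG G n ⊓ D G n = N G n (P n) ⊓ D G n ∧
      ((N G n (P n) ⊓ D G n).subgroupOf (NG G n)).map (boundary G n) =
        ((NG G n ⊓ D G n).subgroupOf (NG G n)).map (boundary G n)) ∧
    (NG G n ⊓ D G n = N G n (Pne n) ⊓ D G n ∧
      ((N G n (Pne n) ⊓ D G n).subgroupOf (NG G n)).map (boundary G n) =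
        ((NG G n ⊓ D G n).subgroupOf (NG G n)).map (boundary G n)) := by
  obtain ⟨n, rfl⟩ : ∃ m, n = m + 1 := ⟨n - 1, by omega⟩
  have h₁ := NG_inf_D_eq (G := G) (n := n) (Q := P (n + 1)) fun _ h => h.1
  have h₂ := NG_inf_D_eq (G := G) (n := n) (Q := Pne (n + 1)) subset_rfl
  exact ⟨⟨h₁, by rw [h₁]⟩, h₂, by rw [h₂]⟩
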